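/- For positive integers $k \le m \le n$, a real number $\sigma$ and a matrix $A \in \mathbb{R}^{m \times n}$, let $\Sigma_k \subset \mathbb{R}^n$ be the set of vectors with at most $k$ non-zero entries, and suppose that one observes $y = A(x + w)$, where $x \in \Sigma_k$ and $w \sim \mathcal{N}(0, \sigma^2 I)$ in $\mathbb{R}^n$. Define the minimax risk $$M^*(A) = \inf_{\hat{x}} \, \sup_{x \in \Sigma_k} \, \mathbb{E}\Big[ \tfrac{1}{n} \| \hat{x}(y) - x \|_2^2 \Big] \in [0, \infty],$$ where the infimum is over all (measurable) estimators $\hat{x} : \mathbb{R}^m \to \mathbb{R}^n$. Then there is an absolute constant $C_1 > 0$, independent of $k$, $m$, $n$, $\sigma$ and $A$, such that for all positive integers $k \le m \le n$, all $\sigma \in \mathbb{R}$ and all $A \in \mathbb{R}^{m \times n}$, $$M^*(A) \ge C_1 \, \frac{k \sigma^2}{m} \, \log(n/k) \qquad \text{and} \qquad M^*(A) \ge \frac{k \sigma^2}{m}.$$ -/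

import Mathlib

open MeasureTheory ProbabilityTheory
open scoped ENNReal

namespace SparseEstimation

/-- `Σ_k`: the vectors of `ℝⁿ` with at most `k` non-zero entries. -/
def sparseVectors (n k : ℕ) : Set (EuclideanSpace ℝ (Fin n)) :=
  {x | (Finset.univ.filter fun i => x i ≠ 0).card ≤ k}

/-- The law `N(0, σ² I)` of the noise on `ℝⁿ`. -/
noncomputable def noiseLaw (n : ℕ) (σ : ℝ) : Measure (EuclideanSpace ℝ (Fin n)) :=
  multivariateGaussian 0 (σ ^ 2 • (1 : Matrix (Fin n) (Fin n) ℝ))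

/-- The risk `𝔼 [(1/n) ‖x̂(y) - x‖²]` at `x` of the estimator `x̂` when the observation is
`y = A (x + w)` with `w ∼ N(0, σ² I)`, as an element of `[0, ∞]`. -/
noncomputable def signalNoiseRisk {m n : ℕ} (σ : ℝ) (A : Matrix (Fin m) (Fin n) ℝ)
    (xhat : EuclideanSpace ℝ (Fin m) → EuclideanSpace ℝ (Fin n))
    (x : EuclideanSpace ℝ (Fin n)) : ℝ≥0∞ :=
  ∫⁻ w, ENNReal.ofReal ((1 / (n : ℝ)) * ‖xhat (A.toEuclideanLin (x + w)) - x‖ ^ 2)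
    ∂(noiseLaw n σ)

/-- The minimax risk `M*(A) = inf_x̂ sup_{x ∈ Σ_k} 𝔼 [(1/n) ‖x̂(y) - x‖²]` for `y = A (x + w)`,
`w ∼ N(0, σ² I)`; the infimum is over all (measurable) estimators `x̂ : ℝᵐ → ℝⁿ`. The value
is in `[0, ∞]`, and is `∞` when every estimator has unbounded risk over `Σ_k`. -/
noncomputable def signalNoiseMinimaxRisk {m n : ℕ} (k : ℕ) (σ : ℝ)
    (A : Matrix (Fin m) (Fin n) ℝ) : ℝ≥0∞ :=
  ⨅ (xhat : EuclideanSpace ℝ (Fin m) → EuclideanSpace ℝ (Fin n)) (_ : Measurable xhat),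
    ⨆ x ∈ sparseVectors n k, signalNoiseRisk σ A xhat x

end SparseEstimation

/-!
The noise enters before `A`, so a signal entry `v` at the coordinate `j` is seen only as a shift of
the noise by `v • u j`, where `u j` is the projection of the `j`-th basis vector to the orthogonal
complement of `ker A` (`effectiveColumn`). The squared norms of the `u j` add up to the rank of
`A`, hence to at most `m` (`sum_norm_effectiveColumn_sq_le`): on average they are at most `m / n`,
which is where the factor `1 / m` of both bounds comes from.

Both bounds are Bayes bounds for a prior with `k` independent parts, each a random vector with at
most one non-zero entry in its own block of coordinates. Revealing all other parts splits the risk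
into `k` separate Bayes risks (`sum_le_signalNoiseMinimaxRisk`), and a shift of the Gaussian noise
is a change of measure with an explicit density (`lintegral_noiseLaw_add`).

* Blocks of one coordinate with a Gaussian entry of variance `1 / q`. Completing the square in the
  density gives the Bayes risk `1 / (q + ‖u j‖² / σ²)` (`gaussian_bayes_risk_ge`). For `k`
  coordinates whose squared norms have at most the average sum `k m / n`, the Cauchy–Schwarz
  inequality and `q → 0` yield `k σ² / m`.
* Blocks of `N ≈ n / (2 k)` coordinates with `‖u j‖² ≤ 2 m / n`, and a spike of height `r` at a
  uniformly random place. The events that the estimate is close to one of the `N` candidates are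
  disjoint, so their noise probability is at most `1 / N` on average. By Cauchy–Schwarz, an event
  of noise probability `p` has probability at most `exp (r² ‖u j‖² / (2 σ²)) √p` after the shift by
  `r • u j` (`measureReal_add_mem_le`). For `r²` a small multiple of `σ² (n / m) log N` the
  estimate therefore misses the spike with probability at least `1 / 2` on average
  (`spike_bayes_risk_ge`). This needs `n / k` large; for bounded `n / k` the bound without the
  logarithm is enough.
-/

namespace SparseEstimation

/-! ### Shifting the Gaussian noise -/

theorem posSemidef_sq_smul_one (n : ℕ) (σ : ℝ) :
    (σ ^ 2 • (1 : Matrix (Fin n) (Fin n) ℝ)).PosSemidef :=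
  Matrix.PosSemidef.one.smul (sq_nonneg σ)

instance (n : ℕ) (σ : ℝ) : IsProbabilityMeasure (noiseLaw n σ) := by
  unfold noiseLaw; infer_instance

theorem noiseLaw_eq_map_pi (n : ℕ) (σ : ℝ) :
    noiseLaw n σ =
      (Measure.pi fun _ : Fin n => gaussianReal 0 (σ ^ 2).toNNReal).map (WithLp.toLp 2) := by
  have : IsProbabilityMeasure
      ((Measure.pi fun _ : Fin n => gaussianReal 0 (σ ^ 2).toNNReal).map (WithLp.toLp 2)) :=
    Measure.isProbabilityMeasure_map (by fun_prop)
  refine Measure.ext_of_charFun (funext fun t => ?_)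
  rw [charFun_pi, noiseLaw, charFun_multivariateGaussian (posSemidef_sq_smul_one n σ)]
  simp only [charFun_gaussianReal, ← Complex.exp_sum]
  congr 1
  simp [Matrix.smul_mulVec, dotProduct, Real.coe_toNNReal _ (sq_nonneg σ),
    Finset.sum_div]
  refine Finset.sum_congr rfl fun i _ => ?_
  ring

/-- The density of `w + u` with respect to the law of the noise `w`. -/
noncomputable def shiftDensity {n : ℕ} (σ : ℝ) (u w : EuclideanSpace ℝ (Fin n)) : ℝ :=
  Real.exp (inner ℝ u w / σ ^ 2 - ‖u‖ ^ 2 / (2 * σ ^ 2))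

theorem shiftDensity_pos {n : ℕ} (σ : ℝ) (u w : EuclideanSpace ℝ (Fin n)) :
    0 < shiftDensity σ u w := Real.exp_pos _

@[fun_prop]
theorem continuous_shiftDensity {n : ℕ} (σ : ℝ) (u : EuclideanSpace ℝ (Fin n)) :
    Continuous (shiftDensity σ u) := by
  unfold shiftDensity; fun_prop

theorem integrable_exp_inner_noiseLaw {n : ℕ} (σ : ℝ) (u : EuclideanSpace ℝ (Fin n)) :
    Integrable (fun w => Real.exp (inner ℝ u w)) (noiseLaw n σ) := by
  rw [noiseLaw_eq_map_pi, integrable_map_measure (by fun_prop) (by fun_prop)]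
  have h : (fun w : EuclideanSpace ℝ (Fin n) => Real.exp (inner ℝ u w)) ∘ (WithLp.toLp 2) =
      fun x : Fin n → ℝ => ∏ i, Real.exp (u i * x i) := by
    ext x
    simp [PiLp.inner_apply, Real.exp_sum, mul_comm]
  rw [h]
  exact Integrable.fintype_prod (f := fun i x => Real.exp (u i * x))
    fun i => integrable_exp_mul_gaussianReal (u i)

theorem integrable_shiftDensity {n : ℕ} (σ : ℝ) (u : EuclideanSpace ℝ (Fin n)) :
    Integrable (shiftDensity σ u) (noiseLaw n σ) := by
  have h := (integrable_exp_inner_noiseLaw σ ((1 / σ ^ 2) • u)).mul_const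
    (Real.exp (-(‖u‖ ^ 2 / (2 * σ ^ 2))))
  refine h.congr (ae_of_all _ fun w => ?_)
  simp only [shiftDensity, ← Real.exp_add, real_inner_smul_left]
  congr 1; ring

/-- The joint exponential transform of the noise, a product of one-dimensional ones. -/
theorem integral_cexp_noiseLaw {n : ℕ} (σ : ℝ) (z : Fin n → ℂ) :
    ∫ w, Complex.exp (∑ i, z i * (w i : ℂ)) ∂(noiseLaw n σ) =
      Complex.exp (∑ i, (σ : ℂ) ^ 2 * z i ^ 2 / 2) := by
  rw [noiseLaw_eq_map_pi, integral_map (by fun_prop) (by fun_prop)]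
  simp only [Complex.exp_sum]
  rw [integral_fintype_prod_eq_prod (f := fun i x => Complex.exp (z i * ((x : ℝ) : ℂ)))]
  refine Finset.prod_congr rfl fun i _ => ?_
  have h := complexMGF_id_gaussianReal (μ := 0) (v := (σ ^ 2).toNNReal) (z i)
  simp only [complexMGF, id] at h
  rw [h]
  simp [Real.coe_toNNReal _ (sq_nonneg σ)]

theorem map_add_noiseLaw {n : ℕ} {σ : ℝ} (hσ : σ ≠ 0) (u : EuclideanSpace ℝ (Fin n)) :
    (noiseLaw n σ).map (fun w => w + u) =
      (noiseLaw n σ).withDensity fun w => ENNReal.ofReal (shiftDensity σ u w) := by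
  have hfin : IsFiniteMeasure
      ((noiseLaw n σ).withDensity fun w => ENNReal.ofReal (shiftDensity σ u w)) :=
    isFiniteMeasure_withDensity_ofReal (integrable_shiftDensity σ u).2
  refine Measure.ext_of_charFun (funext fun t => ?_)
  have hσ' : (σ : ℂ) ≠ 0 := by exact_mod_cast hσ
  have h1 : ∀ w : EuclideanSpace ℝ (Fin n),
      Complex.exp ((inner ℝ (w + u) t : ℝ) * Complex.I) =
        Complex.exp (∑ i, (t i * Complex.I) * (w i : ℂ)) *
          Complex.exp (∑ i, (t i * u i : ℂ) * Complex.I) := by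
    intro w
    rw [← Complex.exp_add]
    congr 1
    simp only [PiLp.inner_apply, RCLike.inner_apply, conj_trivial, PiLp.add_apply]
    push_cast
    rw [Finset.sum_mul, ← Finset.sum_add_distrib]
    refine Finset.sum_congr rfl fun i _ => ?_
    ring
  have h2 : ∀ w : EuclideanSpace ℝ (Fin n),
      (ENNReal.ofReal (shiftDensity σ u w)).toReal •
          Complex.exp ((inner ℝ w t : ℝ) * Complex.I) =
        Complex.exp (∑ i, (t i * Complex.I + u i / σ ^ 2) * (w i : ℂ)) *
          Complex.exp (∑ i, -(u i : ℂ) ^ 2 / (2 * σ ^ 2)) := by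
    intro w
    rw [ENNReal.toReal_ofReal (shiftDensity_pos σ u w).le, shiftDensity, Complex.real_smul,
      Complex.ofReal_exp, ← Complex.exp_add, ← Complex.exp_add]
    congr 1
    simp only [EuclideanSpace.real_norm_sq_eq, PiLp.inner_apply, RCLike.inner_apply, conj_trivial]
    push_cast
    rw [Finset.sum_mul, Finset.sum_div, Finset.sum_div, ← Finset.sum_sub_distrib,
      ← Finset.sum_add_distrib, ← Finset.sum_add_distrib]
    refine Finset.sum_congr rfl fun i _ => ?_
    ring
  rw [charFun_apply, charFun_apply, integral_map (by fun_prop) (by fun_prop),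
    integral_withDensity_eq_integral_toReal_smul (by fun_prop) (by simp)]
  simp only [h1, h2]
  rw [integral_mul_const, integral_mul_const, integral_cexp_noiseLaw, integral_cexp_noiseLaw,
    ← Complex.exp_add, ← Complex.exp_add, ← Finset.sum_add_distrib, ← Finset.sum_add_distrib]
  congr 1
  refine Finset.sum_congr rfl fun i _ => ?_
  field_simp
  ring

theorem lintegral_noiseLaw_add {n : ℕ} {σ : ℝ} (hσ : σ ≠ 0) (u : EuclideanSpace ℝ (Fin n))
    {f : EuclideanSpace ℝ (Fin n) → ℝ≥0∞} (hf : Measurable f) :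
    ∫⁻ w, f (w + u) ∂(noiseLaw n σ) =
      ∫⁻ w, f w * ENNReal.ofReal (shiftDensity σ u w) ∂(noiseLaw n σ) := by
  rw [← lintegral_map (g := fun w => w + u) hf (by fun_prop), map_add_noiseLaw hσ u,
    lintegral_withDensity_eq_lintegral_mul _ (by fun_prop) hf]
  simp [mul_comm]

theorem lintegral_shiftDensity {n : ℕ} {σ : ℝ} (hσ : σ ≠ 0) (u : EuclideanSpace ℝ (Fin n)) :
    ∫⁻ w, ENNReal.ofReal (shiftDensity σ u w) ∂(noiseLaw n σ) = 1 := by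
  simpa using (lintegral_noiseLaw_add hσ u (f := fun _ => 1) measurable_const).symm

theorem lintegral_shiftDensity_sq {n : ℕ} {σ : ℝ} (hσ : σ ≠ 0)
    (u : EuclideanSpace ℝ (Fin n)) :
    ∫⁻ w, ENNReal.ofReal (shiftDensity σ u w ^ 2) ∂(noiseLaw n σ) =
      ENNReal.ofReal (Real.exp (‖u‖ ^ 2 / σ ^ 2)) := by
  have h : ∀ w, shiftDensity σ u w ^ 2 =
      shiftDensity σ ((2 : ℝ) • u) w * Real.exp (‖u‖ ^ 2 / σ ^ 2) := by
    intro w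
    rw [shiftDensity, shiftDensity, ← Real.exp_nat_mul, ← Real.exp_add, norm_smul,
      real_inner_smul_left]
    congr 1
    simp only [Real.norm_ofNat]
    field_simp
    ring
  simp_rw [h, ENNReal.ofReal_mul (shiftDensity_pos _ _ _).le]
  rw [lintegral_mul_const _ (by fun_prop), lintegral_shiftDensity hσ, one_mul]

/-- Cauchy–Schwarz for the shifted law: a set of small noise probability keeps a small
probability after a shift by a short vector. -/
theorem measureReal_add_mem_le {n : ℕ} {σ : ℝ} (hσ : σ ≠ 0) (u : EuclideanSpace ℝ (Fin n))
    {s : Set (EuclideanSpace ℝ (Fin n))} (hs : MeasurableSet s) :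
    (noiseLaw n σ).real {w | w + u ∈ s} ≤
      Real.exp (‖u‖ ^ 2 / (2 * σ ^ 2)) * √((noiseLaw n σ).real s) := by
  have hsu : MeasurableSet {w | w + u ∈ s} := hs.preimage (by fun_prop)
  have h1 : (noiseLaw n σ) {w | w + u ∈ s} =
      ∫⁻ w, (s.indicator 1 w) * ENNReal.ofReal (shiftDensity σ u w) ∂(noiseLaw n σ) := by
    rw [← lintegral_noiseLaw_add hσ u (measurable_one.indicator hs),
      ← lintegral_indicator_one hsu]
    rfl
  have h2 := ENNReal.lintegral_mul_le_Lp_mul_Lq (noiseLaw n σ) Real.HolderConjugate.two_two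
    (f := s.indicator 1) (g := fun w => ENNReal.ofReal (shiftDensity σ u w))
    (measurable_one.indicator hs).aemeasurable (by fun_prop)
  have h3 : ∀ w, (s.indicator (1 : EuclideanSpace ℝ (Fin n) → ℝ≥0∞) w) ^ (2 : ℝ) =
      s.indicator 1 w := by
    intro w; by_cases hw : w ∈ s <;> simp [hw]
  have h4 : ∀ w, ENNReal.ofReal (shiftDensity σ u w) ^ (2 : ℝ) =
      ENNReal.ofReal (shiftDensity σ u w ^ 2) := by
    intro w
    rw [ENNReal.ofReal_rpow_of_pos (shiftDensity_pos _ _ _), Real.rpow_two]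
  simp only [Pi.mul_apply, h3, h4] at h2
  rw [← h1, lintegral_indicator_one hs, lintegral_shiftDensity_sq hσ] at h2
  have h5 := ENNReal.toReal_mono (by finiteness) h2
  have h6 : √(Real.exp (‖u‖ ^ 2 / σ ^ 2)) = Real.exp (‖u‖ ^ 2 / (2 * σ ^ 2)) := by
    rw [← Real.exp_half]
    congr 1
    ring
  rw [ENNReal.toReal_mul, ← ENNReal.toReal_rpow, ← ENNReal.toReal_rpow,
    ENNReal.toReal_ofReal (Real.exp_pos _).le, ← Real.sqrt_eq_rpow, ← Real.sqrt_eq_rpow,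
    h6, mul_comm] at h5
  exact h5

/-! ### Bayes risk for a Gaussian coefficient -/

/-- Among constants, the mean minimizes the mean square error, which is then the variance. -/
theorem ofReal_variance_le_lintegral_gaussianReal (m a : ℝ) (v : NNReal) :
    ENNReal.ofReal v ≤ ∫⁻ θ, ENNReal.ofReal ((a - θ) ^ 2) ∂(gaussianReal m v) := by
  have hL : MemLp (fun θ : ℝ => a - θ) 2 (gaussianReal m v) :=
    (memLp_const a).sub (memLp_id_gaussianReal 2)
  rw [← ofReal_integral_eq_lintegral_ofReal hL.integrable_sq (ae_of_all _ fun _ => sq_nonneg _)]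
  refine ENNReal.ofReal_le_ofReal ?_
  have h := variance_le_expectation_sq (μ := gaussianReal m v) (X := fun θ : ℝ => a - θ)
    (by fun_prop)
  rw [variance_const_sub (by fun_prop)] at h
  simpa using h

/-- Completing the square: an exponential tilt of a centred Gaussian density is, up to a
positive factor, a Gaussian density. -/
theorem exp_mul_gaussianPDFReal {q s : ℝ} (hq : 0 < q) (hs : 0 ≤ s) (a θ : ℝ) :
    Real.exp (θ * a - θ ^ 2 * s / 2) * gaussianPDFReal 0 q⁻¹.toNNReal θ =
      (√(q / (q + s)) * Real.exp (a ^ 2 / (2 * (q + s)))) *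
        gaussianPDFReal (a / (q + s)) (q + s)⁻¹.toNNReal θ := by
  have hqs : 0 < q + s := by linarith
  have e1 : (√(2 * Real.pi * q⁻¹))⁻¹ = √(q / (q + s)) * (√(2 * Real.pi * (q + s)⁻¹))⁻¹ := by
    rw [← Real.sqrt_inv, ← Real.sqrt_inv, ← Real.sqrt_mul (by positivity)]
    congr 1
    field_simp
  simp only [gaussianPDFReal, Real.coe_toNNReal _ (inv_nonneg.2 hq.le),
    Real.coe_toNNReal _ (inv_nonneg.2 hqs.le)]
  rw [e1, mul_left_comm, ← Real.exp_add, mul_mul_mul_comm, ← Real.exp_add]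
  congr 2
  field_simp
  ring

theorem lintegral_tilted_gaussianReal_ge {q s : ℝ} (hq : 0 < q) (hs : 0 ≤ s) (a g : ℝ) :
    ENNReal.ofReal (1 / (q + s)) *
        ∫⁻ θ, ENNReal.ofReal (Real.exp (θ * a - θ ^ 2 * s / 2))
          ∂(gaussianReal 0 q⁻¹.toNNReal) ≤
      ∫⁻ θ, ENNReal.ofReal ((g - θ) ^ 2) * ENNReal.ofReal (Real.exp (θ * a - θ ^ 2 * s / 2))
        ∂(gaussianReal 0 q⁻¹.toNNReal) := by
  have hqs : 0 < q + s := by linarith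
  set c : ℝ := √(q / (q + s)) * Real.exp (a ^ 2 / (2 * (q + s))) with hc
  have hc0 : 0 ≤ c := by positivity
  have key : ∀ F : ℝ → ℝ≥0∞, Measurable F →
      ∫⁻ θ, F θ * ENNReal.ofReal (Real.exp (θ * a - θ ^ 2 * s / 2))
        ∂(gaussianReal 0 q⁻¹.toNNReal) =
      ENNReal.ofReal c * ∫⁻ θ, F θ ∂(gaussianReal (a / (q + s)) (q + s)⁻¹.toNNReal) := by
    intro F hF
    rw [gaussianReal_of_var_ne_zero _ (by simpa using hq),
      gaussianReal_of_var_ne_zero _ (by simpa using hqs),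
      lintegral_withDensity_eq_lintegral_mul _ (by fun_prop) (by fun_prop),
      lintegral_withDensity_eq_lintegral_mul _ (by fun_prop) (by fun_prop),
      ← lintegral_const_mul _ (by fun_prop)]
    refine lintegral_congr fun θ => ?_
    have h := congrArg ENNReal.ofReal (exp_mul_gaussianPDFReal hq hs a θ)
    rw [← hc, ENNReal.ofReal_mul (Real.exp_pos _).le, ENNReal.ofReal_mul hc0] at h
    simp only [Pi.mul_apply, gaussianPDF]
    calc _ = F θ * (ENNReal.ofReal (Real.exp (θ * a - θ ^ 2 * s / 2)) *
          ENNReal.ofReal (gaussianPDFReal 0 q⁻¹.toNNReal θ)) := by ring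
      _ = _ := by rw [h]; ring
  have k1 := key (fun _ => 1) measurable_const
  simp only [one_mul, lintegral_const, measure_univ, mul_one] at k1
  rw [k1, key _ (by fun_prop), mul_comm]
  gcongr
  have h := ofReal_variance_le_lintegral_gaussianReal (a / (q + s)) g (q + s)⁻¹.toNNReal
  rw [Real.coe_toNNReal _ (inv_nonneg.2 hqs.le)] at h
  rwa [one_div]

/-- The Bayes risk for a scalar coefficient `θ ∼ N(0, 1/q)` observed through `w + θ u`. -/
theorem gaussian_bayes_risk_ge {n : ℕ} {σ q : ℝ} (hσ : σ ≠ 0) (hq : 0 < q)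
    (u : EuclideanSpace ℝ (Fin n)) {g : EuclideanSpace ℝ (Fin n) → ℝ} (hg : Measurable g) :
    ENNReal.ofReal (1 / (q + ‖u‖ ^ 2 / σ ^ 2)) ≤
      ∫⁻ θ, ∫⁻ w, ENNReal.ofReal ((g (w + θ • u) - θ) ^ 2) ∂(noiseLaw n σ)
        ∂(gaussianReal 0 q⁻¹.toNNReal) := by
  have hsd : ∀ (θ : ℝ) (w : EuclideanSpace ℝ (Fin n)), shiftDensity σ (θ • u) w =
      Real.exp (θ * (inner ℝ u w / σ ^ 2) - θ ^ 2 * (‖u‖ ^ 2 / σ ^ 2) / 2) := by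
    intro θ w
    rw [shiftDensity, real_inner_smul_left, norm_smul, mul_pow, Real.norm_eq_abs, sq_abs]
    congr 1
    field_simp
  have h1 : ∀ θ : ℝ, ∫⁻ w, ENNReal.ofReal ((g (w + θ • u) - θ) ^ 2) ∂(noiseLaw n σ) =
      ∫⁻ w, ENNReal.ofReal ((g w - θ) ^ 2) * ENNReal.ofReal
        (Real.exp (θ * (inner ℝ u w / σ ^ 2) - θ ^ 2 * (‖u‖ ^ 2 / σ ^ 2) / 2))
          ∂(noiseLaw n σ) := by
    intro θ
    rw [lintegral_noiseLaw_add hσ (θ • u) (f := fun w => ENNReal.ofReal ((g w - θ) ^ 2))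
      (by fun_prop)]
    simp only [hsd]
  have h2 : ∫⁻ θ, ∫⁻ w, ENNReal.ofReal
        (Real.exp (θ * (inner ℝ u w / σ ^ 2) - θ ^ 2 * (‖u‖ ^ 2 / σ ^ 2) / 2))
          ∂(noiseLaw n σ) ∂(gaussianReal 0 q⁻¹.toNNReal) = 1 := by
    simp only [← hsd, lintegral_shiftDensity hσ]
    simp
  simp only [h1]
  rw [lintegral_lintegral_swap (by fun_prop)] at h2 ⊢
  calc _ = ENNReal.ofReal (1 / (q + ‖u‖ ^ 2 / σ ^ 2)) * 1 := (mul_one _).symm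
    _ = _ := by rw [← h2, ← lintegral_const_mul _ (by fun_prop)]
    _ ≤ _ := lintegral_mono fun w => lintegral_tilted_gaussianReal_ge hq (by positivity) _ _

/-! ### Bayes risk for a spike at an unknown place -/

/-- A vector with one entry `r`, at a uniformly random one of `N` places, observed through
`w + u i`. The sets where the estimate is within `r / √2` of the `i`-th candidate are disjoint,
so that on average they have noise probability at most `1 / N`. -/
theorem spike_bayes_risk_ge {n N : ℕ} {σ r s : ℝ} (hσ : σ ≠ 0)
    (u : Fin N → EuclideanSpace ℝ (Fin n)) (hu : ∀ i, ‖u i‖ ^ 2 / σ ^ 2 ≤ s)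
    {g : EuclideanSpace ℝ (Fin n) → Fin N → ℝ} (hg : Measurable g) :
    ENNReal.ofReal (N * (r ^ 2 / 2 * (1 - Real.exp (s / 2) / √N))) ≤
      ∑ i, ∫⁻ w, ENNReal.ofReal (∑ j, (g (w + u i) j - if j = i then r else 0) ^ 2)
        ∂(noiseLaw n σ) := by
  set μ := noiseLaw n σ with hμ
  let S : Fin N → Set (EuclideanSpace ℝ (Fin n)) := fun i =>
    {w | ∑ j, (g w j - if j = i then r else 0) ^ 2 < r ^ 2 / 2}
  have hg' : ∀ j, Measurable fun w => g w j := fun j => (measurable_pi_apply j).comp hg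
  have hS : ∀ i, MeasurableSet (S i) := fun i =>
    measurableSet_lt (Finset.measurable_sum _ fun j _ => ((hg' j).sub_const _).pow_const 2)
      measurable_const
  have hdisj : Pairwise (Function.onFun Disjoint S) := by
    intro i j hij
    refine Set.disjoint_left.2 fun w hi hj => ?_
    simp only [S, Set.mem_ofPred_eq] at hi hj
    -- the two candidates are at distance `√2 r`, by coordinates `i` and `j`
    have hi' := (Finset.sum_le_sum_of_subset_of_nonneg (Finset.subset_univ {i, j})
      fun l _ _ => sq_nonneg (g w l - if l = i then r else 0)).trans_lt hi
    have hj' := (Finset.sum_le_sum_of_subset_of_nonneg (Finset.subset_univ {i, j})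
      fun l _ _ => sq_nonneg (g w l - if l = j then r else 0)).trans_lt hj
    rw [Finset.sum_pair hij] at hi' hj'
    simp only [if_true, if_neg hij, if_neg hij.symm] at hi' hj'
    nlinarith [sq_nonneg (2 * g w i - r), sq_nonneg (2 * g w j - r)]
  have hsum : ∑ i, μ.real (S i) ≤ 1 := by
    rw [← measureReal_biUnion_finset (fun i _ j _ hij => hdisj hij) fun i _ => hS i]
    exact measureReal_le_one
  have hsqrt : ∑ i, √(μ.real (S i)) ≤ √N := by
    refine Real.le_sqrt_of_sq_le ?_
    calc (∑ i, √(μ.real (S i))) ^ 2 ≤ N * ∑ i, √(μ.real (S i)) ^ 2 := by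
          simpa using sq_sum_le_card_mul_sum_sq (s := Finset.univ)
            (f := fun i => √(μ.real (S i)))
      _ ≤ N := by
          simp only [Real.sq_sqrt measureReal_nonneg]
          exact mul_le_of_le_one_right (by positivity) hsum
  have hterm : ∀ i, ENNReal.ofReal (r ^ 2 / 2 * (1 - Real.exp (s / 2) * √(μ.real (S i)))) ≤
      ∫⁻ w, ENNReal.ofReal (∑ j, (g (w + u i) j - if j = i then r else 0) ^ 2) ∂μ := by
    intro i
    have hT : MeasurableSet {w | w + u i ∈ S i} := (hS i).preimage (by fun_prop)
    have hP : μ.real {w | w + u i ∈ S i} ≤ Real.exp (s / 2) * √(μ.real (S i)) := by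
      refine (measureReal_add_mem_le hσ (u i) (hS i)).trans ?_
      have h := hu i
      have h' : ‖u i‖ ^ 2 / (2 * σ ^ 2) = ‖u i‖ ^ 2 / σ ^ 2 / 2 := by ring
      exact mul_le_mul_of_nonneg_right (Real.exp_le_exp.2 (by linarith)) (Real.sqrt_nonneg _)
    calc _ ≤ ENNReal.ofReal (r ^ 2 / 2 * μ.real {w | w + u i ∈ S i}ᶜ) := by
          rw [probReal_compl_eq_one_sub hT]
          gcongr
      _ = ∫⁻ w in {w | w + u i ∈ S i}ᶜ, ENNReal.ofReal (r ^ 2 / 2) ∂μ := by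
          rw [setLIntegral_const, ENNReal.ofReal_mul (by positivity), ofReal_measureReal]
      _ ≤ ∫⁻ w in {w | w + u i ∈ S i}ᶜ,
            ENNReal.ofReal (∑ j, (g (w + u i) j - if j = i then r else 0) ^ 2) ∂μ :=
          setLIntegral_mono' hT.compl fun w hw => ENNReal.ofReal_le_ofReal (not_lt.1 hw)
      _ ≤ _ := setLIntegral_le_lintegral _ _
  refine le_trans ?_ (Finset.sum_le_sum fun i _ => hterm i)
  refine le_trans (ENNReal.ofReal_le_ofReal ?_) (Finset.le_sum_of_subadditive ENNReal.ofReal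
    ENNReal.ofReal_zero.le (fun _ _ => ENNReal.ofReal_add_le) Finset.univ _)
  rw [← Finset.mul_sum, Finset.sum_sub_distrib, ← Finset.mul_sum]
  simp only [Finset.sum_const, Finset.card_univ, Fintype.card_fin, nsmul_eq_mul, mul_one]
  have h : (N : ℝ) / √N = √N := Real.div_sqrt
  calc _ = r ^ 2 / 2 * (N - Real.exp (s / 2) * (N / √N)) := by ring
    _ ≤ _ := by rw [h]; gcongr

/-! ### Independent priors on disjoint blocks of coordinates -/

/-- If averaging over each coordinate separately, the others being frozen, gives at least `c`,
so does averaging over all of them. -/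
theorem le_lintegral_pi_of_forall_update {ι Θ : Type*} [Fintype ι] [DecidableEq ι]
    [MeasurableSpace Θ] (ν : Measure Θ) [IsProbabilityMeasure ν] {F : (ι → Θ) → ℝ≥0∞}
    (hF : Measurable F) (b : ι) (c : ℝ≥0∞)
    (h : ∀ θ : ι → Θ, c ≤ ∫⁻ t, F (Function.update θ b t) ∂ν) :
    c ≤ ∫⁻ θ, F θ ∂(Measure.pi fun _ => ν) := by
  have hΘ : Nonempty Θ := ν.nonempty_of_neZero
  obtain ⟨t₀⟩ := hΘ
  rw [lintegral_eq_lmarginal_univ (fun _ => t₀), lmarginal_erase' _ hF (Finset.mem_univ b)]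
  calc c = (∫⋯∫⁻_Finset.univ.erase b, (fun _ => c) ∂fun _ => ν) fun _ => t₀ := by
        simp [lmarginal]
    _ ≤ _ := lmarginal_mono (fun θ => h θ) _

/-- The vector of `ℝⁿ` with entries `v` on the coordinates listed by `e`, for `e` injective. -/
noncomputable def blockVector {n N : ℕ} (e : Fin N → Fin n) (v : Fin N → ℝ) :
    EuclideanSpace ℝ (Fin n) :=
  ∑ i, v i • EuclideanSpace.single (e i) (1 : ℝ)

theorem measurable_blockVector {n N : ℕ} (e : Fin N → Fin n) : Measurable (blockVector e) := by
  unfold blockVector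
  fun_prop

theorem sum_blockVector_apply {k n N : ℕ} {e : Fin k → Fin N → Fin n}
    (he : Function.Injective2 e) (v : Fin k → Fin N → ℝ) (b : Fin k) (j : Fin N) :
    (∑ b', blockVector (e b') (v b')) (e b j) = v b j := by
  have h : ∀ b' i, (e b j = e b' i) ↔ (b' = b ∧ i = j) :=
    fun b' i => ⟨fun h => ⟨(he h).1.symm, (he h).2.symm⟩, fun h => by rw [h.1, h.2]⟩
  simp [blockVector, WithLp.ofLp_sum, Finset.sum_apply, Pi.single_apply, h, ite_and]

theorem sum_blockVector_mem_sparseVectors {k n N : ℕ} {e : Fin k → Fin N → Fin n}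
    {v : Fin k → Fin N → ℝ} (hv : ∀ b, ∃ j, ∀ i, i ≠ j → v b i = 0) :
    (∑ b, blockVector (e b) (v b)) ∈ sparseVectors n k := by
  choose j hj using hv
  have hb : ∀ b, blockVector (e b) (v b) =
      v b (j b) • EuclideanSpace.single (e b (j b)) (1 : ℝ) := by
    intro b
    refine Finset.sum_eq_single _ (fun i _ hi => ?_) (by simp)
    rw [hj b i hi, zero_smul]
  refine (Finset.card_le_card (t := Finset.univ.image fun b => e b (j b)) fun l hl => ?_).trans
    (Finset.card_image_le.trans (by simp))
  by_contra hne
  simp only [Finset.mem_image, Finset.mem_univ, true_and, not_exists] at hne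
  refine (Finset.mem_filter.1 hl).2 ?_
  simp only [hb, WithLp.ofLp_sum, Finset.sum_apply]
  refine Finset.sum_eq_zero fun b _ => ?_
  simp [Ne.symm (hne b)]

theorem sum_block_error_le {k n N : ℕ} {e : Fin k → Fin N → Fin n}
    (he : Function.Injective2 e) (v : Fin k → Fin N → ℝ) (y : EuclideanSpace ℝ (Fin n)) :
    ∑ b, ∑ j, (y (e b j) - v b j) ^ 2 ≤ ‖y - ∑ b, blockVector (e b) (v b)‖ ^ 2 := by
  set x := ∑ b, blockVector (e b) (v b) with hx
  rw [EuclideanSpace.real_norm_sq_eq, ← Fintype.sum_prod_type']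
  have hinj : Function.Injective fun p : Fin k × Fin N => e p.1 p.2 :=
    fun p q h => Prod.ext (he h).1 (he h).2
  calc _ = ∑ p : Fin k × Fin N, (y - x) (e p.1 p.2) ^ 2 := by
        refine Finset.sum_congr rfl fun p _ => ?_
        rw [PiLp.sub_apply, hx, sum_blockVector_apply he]
    _ = ∑ l ∈ Finset.univ.image fun p : Fin k × Fin N => e p.1 p.2, (y - x) l ^ 2 := by
        rw [Finset.sum_image fun p _ q _ h => hinj h]
    _ ≤ _ := Finset.sum_le_sum_of_subset_of_nonneg (Finset.subset_univ _)
        fun _ _ _ => sq_nonneg _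

theorem sum_lintegral_block_error_le {Ω : Type*} [MeasurableSpace Ω] {k n N : ℕ}
    {e : Fin k → Fin N → Fin n} (he : Function.Injective2 e) (μ : Measure Ω)
    {Y : Ω → EuclideanSpace ℝ (Fin n)} (hY : Measurable Y) (v : Fin k → Fin N → ℝ) :
    ENNReal.ofReal (1 / n) * ∑ b, ∫⁻ w, ENNReal.ofReal (∑ j, (Y w (e b j) - v b j) ^ 2) ∂μ ≤
      ∫⁻ w, ENNReal.ofReal ((1 / (n : ℝ)) * ‖Y w - ∑ b, blockVector (e b) (v b)‖ ^ 2) ∂μ := by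
  rw [← lintegral_finsetSum _ fun b _ => by fun_prop, ← lintegral_const_mul _ (by fun_prop)]
  refine lintegral_mono fun w => ?_
  rw [ENNReal.ofReal_mul (by positivity),
    ← ENNReal.ofReal_sum_of_nonneg fun b _ => Finset.sum_nonneg fun j _ => sq_nonneg _]
  gcongr
  exact sum_block_error_le he v (Y w)

/-- The minimax risk is at least the sum of the Bayes risks of `k` separate problems: in each
block of coordinates `e b` a vector `f θ` with at most one non-zero entry is to be estimated,
where `θ ∼ ν` and the entries `x'` outside the block are known. -/
theorem sum_le_signalNoiseMinimaxRisk {m n k N : ℕ} (σ : ℝ) (A : Matrix (Fin m) (Fin n) ℝ)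
    {e : Fin k → Fin N → Fin n} (he : Function.Injective2 e)
    {Θ : Type*} [MeasurableSpace Θ] (ν : Measure Θ) [IsProbabilityMeasure ν]
    {f : Θ → Fin N → ℝ} (hf : Measurable f) (hf1 : ∀ θ, ∃ j, ∀ i, i ≠ j → f θ i = 0)
    (c : Fin k → ℝ≥0∞)
    (hc : ∀ b (x' : EuclideanSpace ℝ (Fin n))
      (xhat : EuclideanSpace ℝ (Fin m) → EuclideanSpace ℝ (Fin n)), Measurable xhat →
      c b ≤ ∫⁻ θ, ∫⁻ w, ENNReal.ofReal (∑ j,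
        (xhat (A.toEuclideanLin (x' + blockVector (e b) (f θ) + w)) (e b j) - f θ j) ^ 2)
          ∂(noiseLaw n σ) ∂ν) :
    ENNReal.ofReal (1 / n) * ∑ b, c b ≤ signalNoiseMinimaxRisk k σ A := by
  refine le_iInf₂ fun xhat hx => ?_
  have hA : Measurable A.toEuclideanLin :=
    (LinearMap.continuous_of_finiteDimensional _).measurable
  let X : (Fin k → Θ) → EuclideanSpace ℝ (Fin n) := fun θ => ∑ b, blockVector (e b) (f (θ b))
  have hX : Measurable X := Finset.measurable_sum _ fun b _ =>
    (measurable_blockVector (e b)).comp (hf.comp (measurable_pi_apply b))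
  have hXmem : ∀ θ, X θ ∈ sparseVectors n k := fun θ =>
    sum_blockVector_mem_sparseVectors fun b => hf1 (θ b)
  let F : Fin k → (Fin k → Θ) → ℝ≥0∞ := fun b θ => ∫⁻ w, ENNReal.ofReal (∑ j,
    (xhat (A.toEuclideanLin (X θ + w)) (e b j) - f (θ b) j) ^ 2) ∂(noiseLaw n σ)
  have hfm : ∀ b j, Measurable fun θ : Fin k → Θ => f (θ b) j := fun b j =>
    (measurable_pi_apply j).comp (hf.comp (measurable_pi_apply b))
  have hF2 : ∀ b, Measurable fun p : (Fin k → Θ) × EuclideanSpace ℝ (Fin n) =>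
      ENNReal.ofReal (∑ j,
        (xhat (A.toEuclideanLin (X p.1 + p.2)) (e b j) - f (p.1 b) j) ^ 2) := by
    intro b
    refine ENNReal.measurable_ofReal.comp (Finset.measurable_sum _ fun j _ => ?_)
    have h1 : Measurable fun p : (Fin k → Θ) × EuclideanSpace ℝ (Fin n) =>
        xhat (A.toEuclideanLin (X p.1 + p.2)) :=
      hx.comp (hA.comp ((hX.comp measurable_fst).add measurable_snd))
    have h2 : Measurable fun x : EuclideanSpace ℝ (Fin n) => x (e b j) := by fun_prop
    exact ((h2.comp h1).sub ((hfm b j).comp measurable_fst)).pow_const 2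
  have hF : ∀ b, Measurable (F b) := fun b => (hF2 b).lintegral_prod_right'
  have hrisk : ∀ θ, ENNReal.ofReal (1 / n) * ∑ b, F b θ ≤ signalNoiseRisk σ A xhat (X θ) := by
    intro θ
    have hY : Measurable fun w => xhat (A.toEuclideanLin (X θ + w)) :=
      hx.comp (hA.comp (measurable_const.add measurable_id))
    exact sum_lintegral_block_error_le he (noiseLaw n σ) hY fun b => f (θ b)
  have hblock : ∀ b, c b ≤ ∫⁻ θ, F b θ ∂(Measure.pi fun _ => ν) := by
    intro b
    refine le_lintegral_pi_of_forall_update ν (hF b) b _ fun θ => ?_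
    refine (hc b (∑ b' ∈ Finset.univ.erase b, blockVector (e b') (f (θ b'))) xhat hx).trans
      (le_of_eq (lintegral_congr fun t => ?_))
    have hXu : X (Function.update θ b t) =
        (∑ b' ∈ Finset.univ.erase b, blockVector (e b') (f (θ b'))) +
          blockVector (e b) (f t) := by
      simp only [X]
      rw [← Finset.sum_erase_add _ _ (Finset.mem_univ b), Function.update_self]
      congr 1
      refine Finset.sum_congr rfl fun b' hb' => ?_
      rw [Function.update_of_ne (Finset.ne_of_mem_erase hb')]
    simp only [F, hXu, Function.update_self]
  calc ENNReal.ofReal (1 / n) * ∑ b, c b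
      ≤ ENNReal.ofReal (1 / n) * ∑ b, ∫⁻ θ, F b θ ∂(Measure.pi fun _ => ν) := by
        gcongr with b
        exact hblock b
    _ = ∫⁻ θ, ENNReal.ofReal (1 / n) * ∑ b, F b θ ∂(Measure.pi fun _ => ν) := by
        rw [lintegral_const_mul _ (Finset.measurable_sum _ fun b _ => hF b),
          lintegral_finsetSum _ fun b _ => hF b]
    _ ≤ ∫⁻ _, ⨆ x ∈ sparseVectors n k, signalNoiseRisk σ A xhat x
          ∂(Measure.pi fun _ : Fin k => ν) :=
        lintegral_mono fun θ => (hrisk θ).trans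
          (le_iSup₂ (f := fun x (_ : x ∈ sparseVectors n k) => signalNoiseRisk σ A xhat x)
            (X θ) (hXmem θ))
    _ = _ := by simp

/-! ### Columns modulo the kernel of the sensing matrix -/

/-- The component of the `j`-th standard basis vector orthogonal to `ker A`: the
shortest vector with the same image under `A`. -/
noncomputable def effectiveColumn {m n : ℕ} (A : Matrix (Fin m) (Fin n) ℝ) (j : Fin n) :
    EuclideanSpace ℝ (Fin n) :=
  (LinearMap.ker A.toEuclideanLin)ᗮ.starProjection (EuclideanSpace.single j 1)

theorem toEuclideanLin_effectiveColumn {m n : ℕ} (A : Matrix (Fin m) (Fin n) ℝ) (j : Fin n) :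
    A.toEuclideanLin (effectiveColumn A j) = A.toEuclideanLin (EuclideanSpace.single j 1) := by
  have h := (LinearMap.ker A.toEuclideanLin)ᗮ.sub_starProjection_mem_orthogonal
    (EuclideanSpace.single j (1 : ℝ))
  rw [Submodule.orthogonal_orthogonal, LinearMap.mem_ker, map_sub, sub_eq_zero] at h
  exact h.symm

/-- The trace of the projection to `(ker A)ᗮ` is the rank of `A`. -/
theorem sum_norm_effectiveColumn_sq_le {m n : ℕ} (A : Matrix (Fin m) (Fin n) ℝ) :
    ∑ j, ‖effectiveColumn A j‖ ^ 2 ≤ m := by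
  set K := (LinearMap.ker A.toEuclideanLin)ᗮ with hK
  have hdim : Module.finrank ℝ K ≤ m := by
    have h1 := (LinearMap.ker A.toEuclideanLin).finrank_add_finrank_orthogonal
    have h2 := LinearMap.finrank_range_add_finrank_ker A.toEuclideanLin
    have h3 := Submodule.finrank_le (LinearMap.range A.toEuclideanLin)
    rw [← hK] at h1
    simp only [finrank_euclideanSpace, Fintype.card_fin] at h1 h2 h3
    omega
  let B := stdOrthonormalBasis ℝ K
  have h1 : ∀ j, ‖effectiveColumn A j‖ ^ 2 = ∑ i, ((B i : EuclideanSpace ℝ (Fin n)) j) ^ 2 := by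
    intro j
    have h := B.sum_sq_norm_inner_right
      (K.orthogonalProjectionOnto (EuclideanSpace.single j (1 : ℝ)))
    have h' : ‖effectiveColumn A j‖ =
        ‖K.orthogonalProjectionOnto (EuclideanSpace.single j (1 : ℝ))‖ := rfl
    rw [h', ← h]
    refine Finset.sum_congr rfl fun i _ => ?_
    rw [Submodule.inner_orthogonalProjectionOnto_eq_of_mem_left, EuclideanSpace.inner_single_right]
    simp
  simp only [h1]
  rw [Finset.sum_comm]
  have h2 : ∀ i, ∑ j, ((B i : EuclideanSpace ℝ (Fin n)) j) ^ 2 = 1 := by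
    intro i
    rw [← EuclideanSpace.real_norm_sq_eq, Submodule.norm_coe, B.norm_eq_one, one_pow]
  simp only [h2]
  simpa using hdim

/-- The observation of a signal is a function of the noise shifted by effective columns. -/
theorem toEuclideanLin_add_blockVector {m n N : ℕ} (A : Matrix (Fin m) (Fin n) ℝ)
    (e : Fin N → Fin n) (v : Fin N → ℝ) (x w : EuclideanSpace ℝ (Fin n)) :
    A.toEuclideanLin (x + blockVector e v + w) =
      A.toEuclideanLin (x + (w + ∑ i, v i • effectiveColumn A (e i))) := by
  simp only [blockVector, map_add, map_sum, map_smul, toEuclideanLin_effectiveColumn]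
  abel

/-! ### The bound without the logarithm -/

/-- Some `k` of `n` numbers have at most the average sum; cyclic windows are enough to see it. -/
theorem exists_injective_sum_le {k n : ℕ} (hk : k ≤ n) (hn : 0 < n) (a : Fin n → ℝ) :
    ∃ e : Fin k → Fin n, Function.Injective e ∧ ∑ b, a (e b) ≤ k / n * ∑ j, a j := by
  have : NeZero n := ⟨hn.ne'⟩
  have hn' : (0 : ℝ) < n := by exact_mod_cast hn
  have h : ∑ i : Fin n, ∑ b : Fin k, a (Fin.castLE hk b + i) ≤
      ∑ _i : Fin n, (k / n * ∑ j, a j) := by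
    rw [Finset.sum_comm]
    have hb : ∀ b : Fin k, ∑ i, a (Fin.castLE hk b + i) = ∑ j, a j := fun b =>
      Equiv.sum_comp (Equiv.addLeft (Fin.castLE hk b)) a
    simp only [hb, Finset.sum_const, Finset.card_univ, Fintype.card_fin, nsmul_eq_mul]
    refine le_of_eq ?_
    field_simp
  obtain ⟨i, -, hi⟩ := Finset.exists_le_of_sum_le Finset.univ_nonempty h
  exact ⟨fun b => Fin.castLE hk b + i,
    (add_left_injective i).comp (Fin.castLE_injective hk), hi⟩

/-- Independent priors `N(0, 1/q)` on the coordinates listed by `e`. -/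
theorem sum_inv_le_signalNoiseMinimaxRisk {m n k : ℕ} {σ q : ℝ} (hσ : σ ≠ 0) (hq : 0 < q)
    (A : Matrix (Fin m) (Fin n) ℝ) {e : Fin k → Fin n} (he : Function.Injective e) :
    ENNReal.ofReal (1 / n) *
        ∑ b, ENNReal.ofReal (1 / (q + ‖effectiveColumn A (e b)‖ ^ 2 / σ ^ 2)) ≤
      signalNoiseMinimaxRisk k σ A := by
  refine sum_le_signalNoiseMinimaxRisk (N := 1) (e := fun b _ => e b) σ A
    (fun b b' j j' h => ⟨he h, Subsingleton.elim _ _⟩) (gaussianReal 0 q⁻¹.toNNReal)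
    (f := fun θ _ => θ) (by fun_prop)
    (fun θ => ⟨0, fun i hi => absurd (Subsingleton.elim i 0) hi⟩) _ fun b x' xhat hx => ?_
  have hA : Measurable A.toEuclideanLin :=
    (LinearMap.continuous_of_finiteDimensional _).measurable
  refine (gaussian_bayes_risk_ge hσ hq (effectiveColumn A (e b))
    (g := fun v => xhat (A.toEuclideanLin (x' + v)) (e b)) ?_).trans ?_
  · have h : Measurable fun v => xhat (A.toEuclideanLin (x' + v)) :=
      hx.comp (hA.comp (measurable_const.add measurable_id))
    fun_prop
  · simp [toEuclideanLin_add_blockVector]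

theorem div_le_signalNoiseMinimaxRisk {k m n : ℕ} (hk : 0 < k) (hkm : k ≤ m) (hmn : m ≤ n)
    {σ : ℝ} (hσ : σ ≠ 0) (A : Matrix (Fin m) (Fin n) ℝ) :
    ENNReal.ofReal ((k : ℝ) * σ ^ 2 / (m : ℝ)) ≤ signalNoiseMinimaxRisk k σ A := by
  have hm : 0 < m := by omega
  have hn : 0 < n := by omega
  have hk' : (0 : ℝ) < k := by exact_mod_cast hk
  have hm' : (0 : ℝ) < m := by exact_mod_cast hm
  have hn' : (0 : ℝ) < n := by exact_mod_cast hn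
  obtain ⟨e, he, hsum⟩ := exists_injective_sum_le (hkm.trans hmn) hn
    fun j => ‖effectiveColumn A j‖ ^ 2
  have hsum' : ∑ b, ‖effectiveColumn A (e b)‖ ^ 2 ≤ k / n * m :=
    hsum.trans (by gcongr; exact sum_norm_effectiveColumn_sq_le A)
  have hq : ∀ q : ℝ, 0 < q →
      ENNReal.ofReal (1 / n * (k / (q + m / (n * σ ^ 2)))) ≤ signalNoiseMinimaxRisk k σ A := by
    intro q hq
    refine le_trans ?_ (sum_inv_le_signalNoiseMinimaxRisk hσ hq A he)
    rw [← ENNReal.ofReal_sum_of_nonneg fun b _ => by positivity,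
      ← ENNReal.ofReal_mul (by positivity)]
    refine ENNReal.ofReal_le_ofReal (mul_le_mul_of_nonneg_left ?_ (by positivity))
    have h1 := Finset.sq_sum_div_le_sum_sq_div Finset.univ (fun _ : Fin k => (1 : ℝ))
      (g := fun b => q + ‖effectiveColumn A (e b)‖ ^ 2 / σ ^ 2) fun b _ => by positivity
    simp only [one_pow, Finset.sum_const, Finset.card_univ, Fintype.card_fin, nsmul_eq_mul,
      mul_one, Finset.sum_add_distrib, ← Finset.sum_div] at h1
    refine le_trans ?_ h1
    calc (k : ℝ) / (q + m / (n * σ ^ 2)) = k ^ 2 / (k * q + k / n * m / σ ^ 2) := by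
          field_simp
      _ ≤ _ := by gcongr
  -- the prior variance `1 / q` tends to infinity
  have hlim : Filter.Tendsto (fun q : ℝ => ENNReal.ofReal (1 / n * (k / (q + m / (n * σ ^ 2)))))
      (nhdsWithin 0 (Set.Ioi 0)) (nhds (ENNReal.ofReal ((k : ℝ) * σ ^ 2 / m))) := by
    have h0 : (k : ℝ) * σ ^ 2 / m = 1 / n * (k / (0 + m / (n * σ ^ 2))) := by
      rw [zero_add]
      field_simp
    rw [h0]
    refine ENNReal.tendsto_ofReal (tendsto_nhdsWithin_of_tendsto_nhds ?_)
    have hne : (0 : ℝ) + m / (n * σ ^ 2) ≠ 0 := by positivity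
    exact ContinuousAt.tendsto (f := fun q : ℝ => 1 / n * (k / (q + m / (n * σ ^ 2))))
      (by fun_prop (disch := exact hne))
  exact le_of_tendsto hlim (Filter.eventually_of_mem self_mem_nhdsWithin hq)

/-! ### The bound with the logarithm -/

/-- Independent spikes of height `r`, one in each of `k` disjoint blocks of `N` coordinates and
uniformly placed within its block. -/
theorem spike_le_signalNoiseMinimaxRisk {m n k N : ℕ} {σ r s : ℝ} (hσ : σ ≠ 0) (hN : 0 < N)
    (A : Matrix (Fin m) (Fin n) ℝ) {e : Fin k → Fin N → Fin n} (he : Function.Injective2 e)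
    (hs : ∀ b j, r ^ 2 * ‖effectiveColumn A (e b j)‖ ^ 2 / σ ^ 2 ≤ s) :
    ENNReal.ofReal (k / n * (r ^ 2 / 2 * (1 - Real.exp (s / 2) / √N))) ≤
      signalNoiseMinimaxRisk k σ A := by
  let ν : Measure (Fin N) := (N : ℝ≥0∞)⁻¹ • Measure.count
  have hN0 : (N : ℝ≥0∞) ≠ 0 := by exact_mod_cast hN.ne'
  have hν : IsProbabilityMeasure ν := ⟨by
    simp [ν, ENNReal.inv_mul_cancel hN0 (ENNReal.natCast_ne_top N)]⟩
  set c := r ^ 2 / 2 * (1 - Real.exp (s / 2) / √N) with hc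
  have h := sum_le_signalNoiseMinimaxRisk σ A he ν (f := fun i j => if j = i then r else 0)
    (measurable_of_finite _) (fun i => ⟨i, fun j hj => if_neg hj⟩) (fun _ => ENNReal.ofReal c) ?_
  · refine le_trans (le_of_eq ?_) h
    rw [Finset.sum_const, Finset.card_univ, Fintype.card_fin, nsmul_eq_mul,
      ← ENNReal.ofReal_natCast, ← ENNReal.ofReal_mul (by positivity),
      ← ENNReal.ofReal_mul (by positivity)]
    congr 1
    ring
  · intro b x' xhat hx
    have hA : Measurable A.toEuclideanLin :=
      (LinearMap.continuous_of_finiteDimensional _).measurable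
    have hY : Measurable fun v => xhat (A.toEuclideanLin (x' + v)) :=
      hx.comp (hA.comp (measurable_const.add measurable_id))
    have hb := spike_bayes_risk_ge (r := r) (s := s) hσ
      (fun j => r • effectiveColumn A (e b j))
      (fun j => by simpa [norm_smul, mul_pow] using hs b j)
      (g := fun v j => xhat (A.toEuclideanLin (x' + v)) (e b j))
      (measurable_pi_lambda _ fun j => by fun_prop)
    rw [lintegral_smul_measure, lintegral_count, tsum_fintype, smul_eq_mul]
    simp only [toEuclideanLin_add_blockVector, ite_smul, zero_smul, Finset.sum_ite_eq',
      Finset.mem_univ, if_true]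
    calc ENNReal.ofReal c = (N : ℝ≥0∞)⁻¹ * ENNReal.ofReal (N * c) := by
          rw [ENNReal.ofReal_mul (p := (N : ℝ)) (by positivity), ENNReal.ofReal_natCast, ← mul_assoc,
            ENNReal.inv_mul_cancel hN0 (ENNReal.natCast_ne_top N), one_mul]
      _ ≤ _ := by gcongr

/-- Markov's inequality for the squared norms of the effective columns: at least half of them
are at most twice the average. -/
theorem exists_injective2_norm_effectiveColumn_le {m n k N : ℕ} (hm : 0 < m) (hn : 0 < n)
    (hkN : 2 * (k * N) ≤ n) (A : Matrix (Fin m) (Fin n) ℝ) :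
    ∃ e : Fin k → Fin N → Fin n, Function.Injective2 e ∧
      ∀ b j, ‖effectiveColumn A (e b j)‖ ^ 2 ≤ 2 * m / n := by
  have hm' : (0 : ℝ) < m := by exact_mod_cast hm
  have hn' : (0 : ℝ) < n := by exact_mod_cast hn
  let P : Fin n → Prop := fun j => ‖effectiveColumn A j‖ ^ 2 ≤ 2 * m / n
  classical
  let G := Finset.univ.filter P
  let H := Finset.univ.filter fun j => ¬ P j
  have hGH : G.card + H.card = n := by
    simpa using Finset.card_filter_add_card_filter_not (s := (Finset.univ : Finset (Fin n))) P
  have hH : 2 * H.card ≤ n := by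
    have h1 : (H.card : ℝ) * (2 * m / n) ≤ m := by
      rw [← nsmul_eq_mul]
      refine (Finset.card_nsmul_le_sum H (fun j => ‖effectiveColumn A j‖ ^ 2) _ fun j hj =>
        (not_le.1 (Finset.mem_filter.1 hj).2).le).trans ?_
      exact (Finset.sum_le_sum_of_subset_of_nonneg (Finset.subset_univ _)
        fun _ _ _ => sq_nonneg _).trans (sum_norm_effectiveColumn_sq_le A)
    have h2 : (H.card : ℝ) * 2 ≤ n := by
      rw [mul_div_assoc', div_le_iff₀ hn'] at h1
      nlinarith
    exact_mod_cast (mul_comm (2 : ℝ) _).trans_le h2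
  have hcard : Fintype.card (Fin k × Fin N) ≤ Fintype.card G := by
    simp only [Fintype.card_prod, Fintype.card_fin, Fintype.card_coe]
    omega
  obtain ⟨φ⟩ := Function.Embedding.nonempty_of_card_le hcard
  refine ⟨fun b j => φ (b, j), fun b b' j j' h => ?_, fun b j =>
    (Finset.mem_filter.1 (φ (b, j)).2).2⟩
  exact Prod.ext_iff.1 (φ.injective (Subtype.ext h))

theorem log_le_signalNoiseMinimaxRisk {k m n : ℕ} (hk : 0 < k) (hm : 0 < m)
    (hkn : 64 * k ≤ n) {σ : ℝ} (hσ : σ ≠ 0) (A : Matrix (Fin m) (Fin n) ℝ) :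
    ENNReal.ofReal (1 / 32 * ((k : ℝ) * σ ^ 2 / (m : ℝ)) * Real.log ((n : ℝ) / (k : ℝ))) ≤
      signalNoiseMinimaxRisk k σ A := by
  have hn : 0 < n := by omega
  have hk' : (0 : ℝ) < k := by exact_mod_cast hk
  have hm' : (0 : ℝ) < m := by exact_mod_cast hm
  have hn' : (0 : ℝ) < n := by exact_mod_cast hn
  have hR : (64 : ℝ) ≤ n / k := by
    rw [le_div_iff₀ hk']
    exact_mod_cast hkn
  set R : ℝ := n / k with hRdef
  set N : ℕ := n / (2 * k) with hNdef
  have hkN : 2 * (k * N) ≤ n := by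
    have := Nat.mul_div_le n (2 * k)
    rwa [mul_assoc] at this
  have hNR : R / 4 ≤ N := by
    have h1 : n < 2 * k * (N + 1) := by
      rw [hNdef, mul_add, mul_one]
      exact Nat.lt_mul_div_succ n (by omega)
    have h2 : (n : ℝ) < 2 * k * (N + 1) := by exact_mod_cast h1
    have h3 : R < 2 * (N + 1) := by
      rw [hRdef, div_lt_iff₀ hk']
      linarith
    linarith
  have hN16 : (16 : ℝ) ≤ N := by linarith
  have hN0 : 0 < N := by
    have : (0 : ℝ) < N := by linarith
    exact_mod_cast this
  have hlogN : Real.log R / 2 ≤ Real.log N := by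
    rw [← Real.log_sqrt (by linarith)]
    refine Real.log_le_log (Real.sqrt_pos.2 (by linarith)) (le_trans ?_ hNR)
    rw [Real.sqrt_le_left (by linarith)]
    nlinarith
  have hlogN0 : 0 ≤ Real.log N := Real.log_nonneg (by linarith)
  obtain ⟨e, he, hcol⟩ := exists_injective2_norm_effectiveColumn_le hm hn hkN A
  -- the largest spike with `r² ‖u‖² / σ² ≤ log N / 2` whenever `‖u‖² ≤ 2 m / n`
  set r : ℝ := √(Real.log N * σ ^ 2 * n / (4 * m)) with hr
  have hr2 : r ^ 2 = Real.log N * σ ^ 2 * n / (4 * m) := Real.sq_sqrt (by positivity)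
  have h := spike_le_signalNoiseMinimaxRisk (r := r) (s := Real.log N / 2) hσ hN0 A he
    fun b j => by
      calc _ ≤ r ^ 2 * (2 * m / n) / σ ^ 2 := by gcongr; exact hcol b j
        _ = _ := by rw [hr2]; field_simp; norm_num
  have hhalf : Real.exp (Real.log N / 2 / 2) / √N ≤ 1 / 2 := by
    rw [Real.exp_half, Real.exp_half, Real.exp_log (by linarith)]
    have h4 : (4 : ℝ) ≤ √N := Real.le_sqrt_of_sq_le (by linarith)
    have h2 : (2 : ℝ) ≤ √√N := Real.le_sqrt_of_sq_le (by linarith)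
    have h3 := Real.sq_sqrt (Real.sqrt_nonneg (N : ℝ))
    rw [div_le_iff₀ (by linarith)]
    nlinarith
  refine le_trans (ENNReal.ofReal_le_ofReal ?_) h
  calc 1 / 32 * ((k : ℝ) * σ ^ 2 / m) * Real.log R
      = 1 / 16 * ((k : ℝ) * σ ^ 2 / m) * (Real.log R / 2) := by ring
    _ ≤ 1 / 16 * ((k : ℝ) * σ ^ 2 / m) * Real.log N := by gcongr
    _ = k / n * (r ^ 2 / 2 * (1 / 2)) := by rw [hr2]; field_simp; ring
    _ ≤ _ := by gcongr; linarith

end SparseEstimation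

theorem corollary1 :
    ∃ C₁ : ℝ, 0 < C₁ ∧
      ∀ (k m n : ℕ), 0 < k → k ≤ m → m ≤ n →
        ∀ (σ : ℝ) (A : Matrix (Fin m) (Fin n) ℝ),
          ENNReal.ofReal (C₁ * ((k : ℝ) * σ ^ 2 / (m : ℝ)) * Real.log ((n : ℝ) / (k : ℝ))) ≤
              SparseEstimation.signalNoiseMinimaxRisk k σ A ∧
            ENNReal.ofReal ((k : ℝ) * σ ^ 2 / (m : ℝ)) ≤
              SparseEstimation.signalNoiseMinimaxRisk k σ A := by
  refine ⟨1 / 32, by norm_num, fun k m n hk hkm hmn σ A => ?_⟩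
  rcases eq_or_ne σ 0 with rfl | hσ
  · simp
  have hk' : (0 : ℝ) < k := by exact_mod_cast hk
  have hn' : (0 : ℝ) < n := by exact_mod_cast (by omega : 0 < n)
  have h := SparseEstimation.div_le_signalNoiseMinimaxRisk hk hkm hmn hσ A
  refine ⟨?_, h⟩
  rcases le_or_gt (64 * k) n with hkn | hkn
  · exact SparseEstimation.log_le_signalNoiseMinimaxRisk hk (by omega) hkn hσ A
  · -- here the logarithm is bounded, so the other bound is the stronger one
    refine le_trans (ENNReal.ofReal_le_ofReal ?_) h
    have hlog : Real.log ((n : ℝ) / k) ≤ 32 := by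
      have h64 : (n : ℝ) / k ≤ 2 ^ 6 := by
        rw [div_le_iff₀ hk']
        have : (n : ℝ) < 64 * k := by exact_mod_cast hkn
        linarith
      refine (Real.log_le_log (by positivity) h64).trans ?_
      rw [Real.log_pow]
      have := Real.log_two_lt_d9
      push_cast
      linarith
    have h0 : 0 ≤ (k : ℝ) * σ ^ 2 / m := by positivity
    nlinarith
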